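/- Let $(\Omega,\mu)$ be a $\sigma$-finite measure space with non-atomic $\mu$, and let $\mathcal M(\Omega,\mu)$ be the space of ($\mu$-a.e. classes of) real- or complex-valued $\mu$-measurable functions on $\Omega$. For $f\in\mathcal M(\Omega,\mu)$ and $t>0$ let $f^*(t)=\inf\{s\ge 0:\mu\{|f|>s\}\le t\}$ be its non-increasing rearrangement. For $0<q\le\infty$ let $\|\cdot\|_{q,(c,d)}$ be the usual (quasi-)norm of $L_q(c,d)$; put $1/\infty=0$ and $1/0=\infty$. Let $L_\kappa=L_\kappa(\Omega,\mu)$ and $L_\infty=L_\infty(\Omega,\mu)$ be the Lebesgue spaces, and let $L_{\kappa,\infty}$ be the space of all $f\in\mathcal M(\Omega,\mu)$ with $\sup_{t>0}t^{1/\kappa}f^*(t)<\infty$, with this supremum as quasi-norm. A function $b:(0,\infty)\to(0,\infty)$ is slowly varying, $b\in SV$, if it is Lebesgue measurable and, for every $\varepsilon>0$, $t^{\varepsilon}b(t)$ is equivalent to a non-decreasing positive function and $t^{-\varepsilon}b(t)$ to a non-increasing positive function on $(0,\infty)$ (equivalent: each is bounded by a constant multiple of the other). For a couple $(A_0,A_1)$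 of such spaces and $t>0$ let $$K(t,f;A_0,A_1)=\inf\{\|f_0\|_{A_0}+t\|f_1\|_{A_1}: f=f_0+f_1,\ f_i\in A_i\},$$ and for $a,b\in SV$ and $0<q,r\le\infty$ let $(A_0,A_1)^{\mathcal L}_{\theta,r,b,q,a}$ be the set of all $f\in A_0+A_1$ with $$\Big\|t^{-1/r}b(t)\,\big\|u^{-\theta-1/q}a(u)K(u,f;A_0,A_1)\big\|_{q,(0,t)}\Big\|_{r,(0,\infty)}<\infty .$$ For $0<p\le\infty$ let $L^{\mathcal L}_{p,r,b,q,a}$ be the set of all $f\in\mathcal M(\Omega,\mu)$ with $$\Big\|t^{-1/r}b(t)\,\big\|u^{1/p-1/q}a(u)f^*(u)\big\|_{q,(0,t)}\Big\|_{r,(0,\infty)}<\infty ,$$ and let $L^{(p,q,r}_{b}$ (the small Lorentz–Karamata space) be the set of all $f\in\mathcal M(\Omega,\mu)$ with $$\Big\|t^{-1/r}b(t)\,\big\|u^{1/p-1/q}f^*(u)\big\|_{q,(0,t)}\Big\|_{r,(0,\infty)}<\infty .$$ In each case the displayed expression is the quasi-norm of the space. **Theorem.** Let $0<\theta\le1$,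 $0<\kappa<\infty$, $p=\frac{\kappa}{1-\theta}$ (so $p=\infty$ if $\theta=1$), $0<q,r\le\infty$ and $a,b\in SV$. Put $\tilde a(t)=a(t^{1/\kappa})$ and $\tilde b(t)=b(t^{1/\kappa})$. Then $$(L_\kappa,L_\infty)^{\mathcal L}_{\theta,r,b,q,a}=(L_{\kappa,\infty},L_\infty)^{\mathcal L}_{\theta,r,b,q,a}=L^{\mathcal L}_{p,r,\tilde b,q,\tilde a},$$ and in particular, for $a\equiv1$, $$(L_\kappa,L_\infty)^{\mathcal L}_{\theta,r,b,q,1}=(L_{\kappa,\infty},L_\infty)^{\mathcal L}_{\theta,r,b,q,1}=L^{(p,q,r}_{\tilde b}.$$ Here equality means that the spaces coincide as sets and that their quasi-norms are equivalent. -/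

import Mathlib

open MeasureTheory Set
open scoped ENNReal NNReal

namespace LorentzKaramata

noncomputable section

/-! ### Slowly varying functions on `(0, ∞)` -/

/-- `f ≈ g` for two positive functions on `(0, ∞)`. -/
def EquivOnPos (f g : ℝ → ℝ) : Prop :=
  ∃ c C : ℝ, 0 < c ∧ 0 < C ∧ ∀ t ∈ Ioi (0 : ℝ), c * g t ≤ f t ∧ f t ≤ C * g t

/-- `b ∈ SV`: `b` is positive and Lebesgue measurable on `(0, ∞)` and, for every `ε > 0`,
`t ^ ε * b t` is equivalent to a non-decreasing positive function and `t ^ (-ε) * b t` to a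
non-increasing positive function. Only the values of `b` on `(0, ∞)` matter. -/
structure SlowlyVarying (b : ℝ → ℝ) : Prop where
  aemeasurable : AEMeasurable b (volume.restrict (Ioi 0))
  pos : ∀ t ∈ Ioi (0 : ℝ), 0 < b t
  equiv_mono : ∀ ε : ℝ, 0 < ε → ∃ g : ℝ → ℝ, (∀ t ∈ Ioi (0 : ℝ), 0 < g t) ∧
    MonotoneOn g (Ioi 0) ∧ EquivOnPos (fun t => t ^ ε * b t) g
  equiv_anti : ∀ ε : ℝ, 0 < ε → ∃ g : ℝ → ℝ, (∀ t ∈ Ioi (0 : ℝ), 0 < g t) ∧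
    AntitoneOn g (Ioi 0) ∧ EquivOnPos (fun t => t ^ (-ε) * b t) g

/-! ### Norms of functions on intervals -/

/-- The (quasi-)norm `‖g‖_{q,s}` of `L_q(s)`, `s ⊆ ℝ`, for functions with values in `[0, ∞]`. -/
def normOn (q : ℝ≥0∞) (s : Set ℝ) (g : ℝ → ℝ≥0∞) : ℝ≥0∞ :=
  eLpNorm g q (volume.restrict s)

/-- The real number `1 / q`, for `q ∈ (0, ∞]`, with `1 / ∞ = 0`. -/
def rinv (q : ℝ≥0∞) : ℝ := (q⁻¹).toReal

/-- The expression `‖ t^{-1/r} b(t) ‖ u^{σ - 1/q} a(u) g(u) ‖_{q,(0,t)} ‖_{r,(0,∞)}`. -/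
def leftNorm (σ : ℝ) (r : ℝ≥0∞) (b : ℝ → ℝ) (q : ℝ≥0∞) (a : ℝ → ℝ) (g : ℝ → ℝ≥0∞) : ℝ≥0∞ :=
  normOn r (Ioi 0) fun t => ENNReal.ofReal (t ^ (-rinv r) * b t) *
    normOn q (Ioo 0 t) fun u => ENNReal.ofReal (u ^ (σ - rinv q) * a u) * g u

/-! ### Function spaces as subsets of an ambient space with a quasi-norm -/

/-- A subset of an ambient vector space `V` together with its quasi-norm. -/
structure FnSpace (V : Type*) where
  /-- the elements of the space -/
  carrier : Set V
  /-- the quasi-norm, `[0, ∞]`-valued on `V` -/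
  qnorm : V → ℝ≥0∞

/-- The space of all `f` with finite quasi-norm. -/
def FnSpace.ofNorm {V : Type*} (N : V → ℝ≥0∞) : FnSpace V := ⟨{f | N f < ∞}, N⟩

/-- `X ⊂ Y`: inclusion with continuous (that is, bounded) inclusion map. -/
def FnSpace.Embeds {V : Type*} (X Y : FnSpace V) : Prop :=
  X.carrier ⊆ Y.carrier ∧ ∃ C : ℝ≥0, ∀ f ∈ X.carrier, Y.qnorm f ≤ C * X.qnorm f

/-- `X = Y`: the spaces coincide and their quasi-norms are equivalent. -/
def FnSpace.Same {V : Type*} (X Y : FnSpace V) : Prop := X.Embeds Y ∧ Y.Embeds X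

/-! ### The `K`-functional and the `𝓛` interpolation method -/

/-- Membership in `A₀ + A₁`. -/
def IsSum {V : Type*} [AddCommGroup V] (A₀ A₁ : FnSpace V) (f : V) : Prop :=
  ∃ f₀ ∈ A₀.carrier, ∃ f₁ ∈ A₁.carrier, f = f₀ + f₁

/-- Peetre's functional
`K(t, f) = inf { ‖f₀‖_{A₀} + t ‖f₁‖_{A₁} : f = f₀ + f₁, f₀ ∈ A₀, f₁ ∈ A₁ }`. -/
def peetreK {V : Type*} [AddCommGroup V] (A₀ A₁ : FnSpace V) (t : ℝ) (f : V) : ℝ≥0∞ :=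
  ⨅ (f₀ ∈ A₀.carrier) (f₁ ∈ A₁.carrier) (_ : f = f₀ + f₁),
    A₀.qnorm f₀ + ENNReal.ofReal t * A₁.qnorm f₁

/-- `(A₀, A₁)^𝓛_{θ,r,b,q,a}`: all `f ∈ A₀ + A₁` for which
`‖ t^{-1/r} b(t) ‖ u^{-θ - 1/q} a(u) K(u, f) ‖_{q,(0,t)} ‖_{r,(0,∞)}` is finite. -/
def interpL {V : Type*} [AddCommGroup V] (A₀ A₁ : FnSpace V) (θ : ℝ)
    (r : ℝ≥0∞) (b : ℝ → ℝ) (q : ℝ≥0∞) (a : ℝ → ℝ) : FnSpace V where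
  carrier := {f | IsSum A₀ A₁ f ∧ leftNorm (-θ) r b q a (fun u => peetreK A₀ A₁ u f) < ∞}
  qnorm f := leftNorm (-θ) r b q a fun u => peetreK A₀ A₁ u f

/-! ### Rearrangement-invariant spaces over `(Ω, μ)` -/

/-- `μ` has no atoms: every measurable set of positive measure has a measurable subset of positive,
strictly smaller measure. (Stronger than Mathlib's `NoAtoms`, which only concerns points; it is
used for σ-finite measures, where it is the usual notion.) -/
def NonAtomic {Ω : Type*} [MeasurableSpace Ω] (μ : Measure Ω) : Prop :=
  ∀ A, MeasurableSet A → 0 < μ A → ∃ B ⊆ A, MeasurableSet B ∧ 0 < μ B ∧ μ B < μ A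

section spaces

variable {Ω : Type*} [MeasurableSpace Ω] {μ : Measure Ω} {𝕜 : Type*} [RCLike 𝕜]

/-- The non-increasing rearrangement `f*(t) = inf { s ≥ 0 : μ{|f| > s} ≤ t }`, `t > 0`. -/
def rearr (f : Ω →ₘ[μ] 𝕜) (t : ℝ) : ℝ≥0∞ :=
  sInf {s : ℝ≥0∞ | μ {x | s < ‖f x‖ₑ} ≤ ENNReal.ofReal t}

variable (μ 𝕜)

/-- The Lebesgue space `L_p`, `0 < p ≤ ∞`. -/
def Lebesgue (p : ℝ≥0∞) : FnSpace (Ω →ₘ[μ] 𝕜) := .ofNorm fun f => eLpNorm f p μ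

/-- The Lorentz space `L_{p,∞}` (weak `L_p`), with quasi-norm `sup_{t > 0} t^{1/p} f*(t)`. -/
def WeakLebesgue (p : ℝ≥0∞) : FnSpace (Ω →ₘ[μ] 𝕜) :=
  .ofNorm fun f => ⨆ t ∈ Ioi (0 : ℝ), ENNReal.ofReal (t ^ rinv p) * rearr f t

/-- The `𝓛` Lorentz–Karamata space `L^𝓛_{p,r,b,q,a}`, with quasi-norm
`‖ t^{-1/r} b(t) ‖ u^{1/p - 1/q} a(u) f*(u) ‖_{q,(0,t)} ‖_{r,(0,∞)}`. -/
def LKL (p r : ℝ≥0∞) (b : ℝ → ℝ) (q : ℝ≥0∞) (a : ℝ → ℝ) : FnSpace (Ω →ₘ[μ] 𝕜) :=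
  .ofNorm fun f => leftNorm (rinv p) r b q a (rearr f)

/-- The small Lorentz–Karamata space `L^{(p,q,r}_b`, with quasi-norm
`‖ t^{-1/r} b(t) ‖ u^{1/p - 1/q} f*(u) ‖_{q,(0,t)} ‖_{r,(0,∞)}`. -/
def SmallLK (p q r : ℝ≥0∞) (b : ℝ → ℝ) : FnSpace (Ω →ₘ[μ] 𝕜) :=
  .ofNorm fun f => normOn r (Ioi 0) fun t => ENNReal.ofReal (t ^ (-rinv r) * b t) *
    normOn q (Ioo 0 t) fun u => ENNReal.ofReal (u ^ (rinv p - rinv q)) * rearr f u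

end spaces

end

end LorentzKaramata

/-!
For `u > 0`, the triangle inequality for `f*`, the weak-type inequality `t^{1/κ} f*(t) ≤ ‖f‖_κ` and
truncation of `f` at the level `f*(u^κ)` give
`u f*(u^κ) ≤ K(u, f; L_{κ,∞}, L_∞) ≤ C K(u, f; L_κ, L_∞) ≤ 2 C (∫₀^{u^κ} (f*)^κ)^{1/κ}`.
The two ends have comparable weighted norms: split the integral over the dyadic intervals
`((u / 2^{n+1})^κ, (u / 2^n)^κ)`, on which `f*` is at most its value at the left end. The integral
is then controlled by the dilates `u ↦ w f*(w^κ)`, `w = u / 2^{n+1}`, whose norms decay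
geometrically in `n` because `a` grows more slowly than `l^θ` under dilation by `l`. The
substitution `v = u^κ` turns the norm of `u ↦ u f*(u^κ)` into that of the Lorentz–Karamata space.
-/

namespace LorentzKaramata

/-! ### Comparison of integrals through distribution functions -/

section distribution

variable {α β : Type*} [MeasurableSpace α] [MeasurableSpace β]

theorem volume_setOf_ofReal_lt (m : ℝ≥0∞) :
    volume {s : ℝ | s ∈ Ioi 0 ∧ ENNReal.ofReal s < m} = m := by
  induction m with
  | top =>
    have : {s : ℝ | s ∈ Ioi 0 ∧ ENNReal.ofReal s < ∞} = Ioi 0 := by ext s; simp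
    rw [this, Real.volume_Ioi]
  | coe m =>
    have : {s : ℝ | s ∈ Ioi 0 ∧ ENNReal.ofReal s < m} = Ioo 0 (m : ℝ) := by
      ext s
      refine and_congr_right fun hs => ?_
      rw [← ENNReal.ofReal_coe_nnreal, ENNReal.ofReal_lt_ofReal_iff_of_nonneg (le_of_lt hs)]
    rw [this, Real.volume_Ioo, sub_zero, ENNReal.ofReal_coe_nnreal]

theorem lintegral_eq_lintegral_meas_ofReal_lt (μ : Measure α) {g : α → ℝ≥0∞}
    (hg : AEMeasurable g μ) :
    ∫⁻ x, g x ∂μ = ∫⁻ s in Ioi (0 : ℝ), μ {x | ENNReal.ofReal s < g x} := by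
  by_cases hfin : ∀ᵐ x ∂μ, g x ≠ ∞
  · calc ∫⁻ x, g x ∂μ = ∫⁻ x, ENNReal.ofReal (g x).toReal ∂μ :=
          lintegral_congr_ae (hfin.mono fun x hx => (ENNReal.ofReal_toReal hx).symm)
      _ = ∫⁻ s in Ioi (0 : ℝ), μ {x | s < (g x).toReal} :=
          lintegral_eq_lintegral_meas_lt μ (.of_forall fun _ => ENNReal.toReal_nonneg)
            hg.ennreal_toReal
      _ = _ := setLIntegral_congr_fun measurableSet_Ioi fun s hs =>
          measure_congr <| hfin.mono fun x hx =>
            propext (ENNReal.ofReal_lt_iff_lt_toReal (le_of_lt hs) hx).symm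
  · have htop : μ {x | g x = ∞} ≠ 0 := by simpa [ae_iff] using hfin
    rw [lintegral_eq_top_of_measure_eq_top_ne_zero hg htop, eq_comm, ← top_le_iff]
    calc ∞ = ∫⁻ _ in Ioi (0 : ℝ), μ {x | g x = ∞} := by simp [htop]
      _ ≤ _ := lintegral_mono fun s => measure_mono fun x (hx : g x = ∞) => by simp [hx]

theorem lintegral_rpow_mono_of_meas_lt_le {μ : Measure α} {ν : Measure β} {f : α → ℝ≥0∞}
    {g : β → ℝ≥0∞} (hf : AEMeasurable f μ) (hg : AEMeasurable g ν) {p : ℝ} (hp : 0 < p)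
    (h : ∀ s, μ {x | s < f x} ≤ ν {x | s < g x}) :
    ∫⁻ x, f x ^ p ∂μ ≤ ∫⁻ x, g x ^ p ∂ν := by
  rw [lintegral_eq_lintegral_meas_ofReal_lt μ (hf.pow_const p),
    lintegral_eq_lintegral_meas_ofReal_lt ν (hg.pow_const p)]
  simp only [← ENNReal.rpow_inv_lt_iff hp]
  exact lintegral_mono fun s => h _

end distribution

/-! ### The non-increasing rearrangement and the `K`-functional -/

theorem rinv_ofReal {κ : ℝ} (hκ : 0 ≤ κ) : rinv (ENNReal.ofReal κ) = κ⁻¹ := by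
  rw [rinv, ENNReal.toReal_inv, ENNReal.toReal_ofReal hκ]

theorem rinv_div {θ κ : ℝ} (hθ : θ ≤ 1) (hκ : 0 < κ) :
    rinv (ENNReal.ofReal κ / ENNReal.ofReal (1 - θ)) = (1 - θ) / κ := by
  have hκ₀ : ENNReal.ofReal κ ≠ 0 := by simpa using hκ
  rw [rinv, ENNReal.inv_div (.inl ENNReal.ofReal_ne_top) (.inr hκ₀), ENNReal.toReal_div,
    ENNReal.toReal_ofReal hκ.le, ENNReal.toReal_ofReal (sub_nonneg.2 hθ)]

section rearr

variable {Ω : Type*} [MeasurableSpace Ω] {μ : Measure Ω} {𝕜 : Type*} [RCLike 𝕜]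

theorem rearr_antitone (f : Ω →ₘ[μ] 𝕜) : Antitone (rearr f) := fun _ _ h =>
  sInf_le_sInf fun _ hs => le_trans hs (ENNReal.ofReal_le_ofReal h)

theorem rearr_le {f : Ω →ₘ[μ] 𝕜} {t : ℝ} {s : ℝ≥0∞}
    (h : μ {x | s < ‖f x‖ₑ} ≤ ENNReal.ofReal t) : rearr f t ≤ s := sInf_le h

theorem meas_rearr_lt_le (f : Ω →ₘ[μ] 𝕜) (t : ℝ) :
    μ {x | rearr f t < ‖f x‖ₑ} ≤ ENNReal.ofReal t := by
  have hne : {s : ℝ≥0∞ | μ {x | s < ‖f x‖ₑ} ≤ ENNReal.ofReal t}.Nonempty := ⟨∞, by simp⟩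
  obtain ⟨u, hu, hlim, hmem⟩ := exists_seq_tendsto_sInf hne (OrderBot.bddBelow _)
  calc μ {x | rearr f t < ‖f x‖ₑ} ≤ μ (⋃ n, {x | u n < ‖f x‖ₑ}) := measure_mono fun x hx =>
        mem_iUnion.2 ((tendsto_order.1 hlim).2 _ hx).exists
    _ = ⨆ n, μ {x | u n < ‖f x‖ₑ} := Monotone.measure_iUnion fun _ _ hij _ hx =>
        lt_of_le_of_lt (hu hij) hx
    _ ≤ ENNReal.ofReal t := iSup_le hmem

theorem meas_lt_le_of_rearr_le {f : Ω →ₘ[μ] 𝕜} {t : ℝ} {s : ℝ≥0∞} (h : rearr f t ≤ s) :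
    μ {x | s < ‖f x‖ₑ} ≤ ENNReal.ofReal t :=
  (measure_mono fun _ hx => lt_of_le_of_lt h hx).trans (meas_rearr_lt_le f t)

theorem lt_rearr_iff {f : Ω →ₘ[μ] 𝕜} {t : ℝ} {s : ℝ≥0∞} :
    s < rearr f t ↔ ENNReal.ofReal t < μ {x | s < ‖f x‖ₑ} := by
  simpa only [not_le] using not_congr ⟨meas_lt_le_of_rearr_le (f := f), rearr_le⟩

theorem rearr_add_le (f g : Ω →ₘ[μ] 𝕜) (t : ℝ) :
    rearr (f + g) t ≤ rearr f t + eLpNorm g ∞ μ := by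
  refine rearr_le (le_trans (measure_mono_ae ?_) (meas_rearr_lt_le f t))
  filter_upwards [AEEqFun.coeFn_add f g, ae_le_eLpNormEssSup (f := g) (μ := μ)] with x hfg hg
  intro (hx : _ < _)
  change _ < _
  contrapose! hx
  rw [hfg]
  exact (enorm_add_le _ _).trans (add_le_add hx hg)

theorem rpow_mul_rearr_le_eLpNorm {κ : ℝ} (hκ : 0 < κ) (f : Ω →ₘ[μ] 𝕜) {t : ℝ} (ht : 0 < t) :
    ENNReal.ofReal (t ^ κ⁻¹) * rearr f t ≤ eLpNorm f (ENNReal.ofReal κ) μ := by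
  have hmarkov : ∀ s < rearr f t,
      ENNReal.ofReal t * s ^ κ ≤ eLpNorm f (ENNReal.ofReal κ) μ ^ κ := fun s hs => by
    have h := mul_meas_ge_le_pow_eLpNorm' μ (by simpa using hκ) ENNReal.ofReal_ne_top
      f.aestronglyMeasurable s (p := ENNReal.ofReal κ)
    rw [ENNReal.toReal_ofReal hκ.le, mul_comm] at h
    refine le_trans (mul_le_mul_left ?_ _) h
    exact (lt_rearr_iff.1 hs).le.trans (measure_mono (ofPred_subset_ofPred.2 fun _ => le_of_lt))
  have ht₀ : ENNReal.ofReal (t ^ κ⁻¹) ≠ 0 := by simpa using Real.rpow_pos_of_pos ht κ⁻¹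
  rw [mul_comm, ← ENNReal.le_div_iff_mul_le (.inl ht₀) (.inl ENNReal.ofReal_ne_top)]
  refine le_of_forall_lt_imp_le_of_dense fun s hs => ?_
  rw [ENNReal.le_div_iff_mul_le (.inl ht₀) (.inl ENNReal.ofReal_ne_top), mul_comm,
    ← ENNReal.rpow_le_rpow_iff hκ, ENNReal.mul_rpow_of_nonneg _ _ hκ.le,
    ENNReal.ofReal_rpow_of_pos (by positivity), ← Real.rpow_mul ht.le,
    inv_mul_cancel₀ hκ.ne', Real.rpow_one]
  exact hmarkov s hs

theorem lintegral_indicator_rearr_lt_rpow_le {κ : ℝ} (hκ : 0 < κ) (f : Ω →ₘ[μ] 𝕜) (U : ℝ) :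
    ∫⁻ x, ‖{x | rearr f U < ‖f x‖ₑ}.indicator f x‖ₑ ^ κ ∂μ ≤
      ∫⁻ v in Ioo 0 U, rearr f v ^ κ := by
  have hanti := rearr_antitone f
  have hS : MeasurableSet {x | rearr f U < ‖f x‖ₑ} :=
    measurableSet_lt measurable_const f.measurable.enorm
  refine lintegral_rpow_mono_of_meas_lt_le (f.measurable.indicator hS).enorm.aemeasurable
    hanti.measurable.aemeasurable hκ fun s => ?_
  rw [Measure.restrict_apply (measurableSet_lt measurable_const hanti.measurable)]
  set m := μ {x | max s (rearr f U) < ‖f x‖ₑ}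
  have hmU : m ≤ ENNReal.ofReal U := meas_lt_le_of_rearr_le (le_max_right _ _)
  calc μ {x | s < ‖{x | rearr f U < ‖f x‖ₑ}.indicator f x‖ₑ} ≤ m := measure_mono fun x hx => by
        by_cases hxS : x ∈ {x | rearr f U < ‖f x‖ₑ}
        · rw [mem_ofPred_eq, indicator_of_mem hxS] at hx
          exact max_lt hx hxS
        · simp [indicator_of_notMem hxS] at hx
    _ = volume {v : ℝ | v ∈ Ioi 0 ∧ ENNReal.ofReal v < m} := (volume_setOf_ofReal_lt m).symm
    _ ≤ volume ({v | s < rearr f v} ∩ Ioo 0 U) := measure_mono fun v hv =>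
        ⟨(le_max_left _ _).trans_lt (lt_rearr_iff.2 hv.2), hv.1,
          (ENNReal.ofReal_lt_ofReal_iff_of_nonneg (le_of_lt hv.1)).1 (hv.2.trans_le hmU)⟩

/-- The function `u ↦ (∫₀^{u^κ} h^κ)^{1/κ}`. For `h = f*` it is, up to a constant, the functional
`K(u, f; L_κ, L_∞)`. -/
noncomputable def powerMean (κ : ℝ) (h : ℝ → ℝ≥0∞) (u : ℝ) : ℝ≥0∞ :=
  (∫⁻ v in Ioo 0 (u ^ κ), h v ^ κ) ^ κ⁻¹

theorem mul_le_powerMean {κ : ℝ} (hκ : 0 < κ) {h : ℝ → ℝ≥0∞} (hh : Antitone h) {u : ℝ}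
    (hu : 0 < u) : ENNReal.ofReal u * h (u ^ κ) ≤ powerMean κ h u := by
  rw [powerMean, ENNReal.le_rpow_inv_iff hκ, ENNReal.mul_rpow_of_nonneg _ _ hκ.le,
    ENNReal.ofReal_rpow_of_pos hu]
  calc ENNReal.ofReal (u ^ κ) * h (u ^ κ) ^ κ
      = ∫⁻ _ in Ioo 0 (u ^ κ), h (u ^ κ) ^ κ := by simp [mul_comm]
    _ ≤ _ := setLIntegral_mono' measurableSet_Ioo fun v hv =>
        ENNReal.rpow_le_rpow (hh hv.2.le) hκ.le

theorem exists_add_eq_and_eLpNorm_le {κ : ℝ} (hκ : 0 < κ) (f : Ω →ₘ[μ] 𝕜) (u : ℝ) :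
    ∃ f₀ f₁ : Ω →ₘ[μ] 𝕜, f = f₀ + f₁ ∧
      eLpNorm f₀ (ENNReal.ofReal κ) μ ≤ powerMean κ (rearr f) u ∧
      eLpNorm f₁ ∞ μ ≤ rearr f (u ^ κ) := by
  set S := {x | rearr f (u ^ κ) < ‖f x‖ₑ}
  have hS : MeasurableSet S := measurableSet_lt measurable_const f.measurable.enorm
  have h₀ := f.aestronglyMeasurable.indicator hS
  have h₁ := f.aestronglyMeasurable.indicator hS.compl
  refine ⟨AEEqFun.mk _ h₀, AEEqFun.mk _ h₁, ?_, ?_, ?_⟩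
  · simp only [AEEqFun.mk_add_mk, indicator_self_add_compl, AEEqFun.mk_coeFn]
  · rw [eLpNorm_congr_ae (AEEqFun.coeFn_mk _ _), eLpNorm_eq_lintegral_rpow_enorm_toReal
      (by simpa using hκ) ENNReal.ofReal_ne_top, ENNReal.toReal_ofReal hκ.le, one_div]
    exact ENNReal.rpow_le_rpow (lintegral_indicator_rearr_lt_rpow_le hκ f _) (inv_nonneg.2 hκ.le)
  · rw [eLpNorm_congr_ae (AEEqFun.coeFn_mk _ _), eLpNorm_exponent_top]
    refine eLpNormEssSup_le_of_ae_enorm_bound (.of_forall fun x => ?_)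
    by_cases hx : x ∈ S
    · simp [hx]
    · rw [indicator_of_mem (show x ∈ Sᶜ from hx)]
      exact not_lt.1 hx

theorem mul_rearr_le_peetreK {κ : ℝ} (hκ : 0 < κ) (f : Ω →ₘ[μ] 𝕜) {u : ℝ} (hu : 0 < u) :
    ENNReal.ofReal u * rearr f (u ^ κ) ≤
      peetreK (WeakLebesgue μ 𝕜 (ENNReal.ofReal κ)) (Lebesgue μ 𝕜 ∞) u f := by
  have hweak : ∀ g : Ω →ₘ[μ] 𝕜, ENNReal.ofReal u * rearr g (u ^ κ) ≤
      (WeakLebesgue μ 𝕜 (ENNReal.ofReal κ)).qnorm g := fun g => by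
    refine le_trans (le_of_eq ?_) (le_iSup₂ (u ^ κ) (Real.rpow_pos_of_pos hu κ))
    rw [rinv_ofReal hκ.le, Real.rpow_rpow_inv hu.le hκ.ne']
  refine le_iInf₂ fun f₀ _ => le_iInf₂ fun f₁ _ => le_iInf fun hf => ?_
  calc ENNReal.ofReal u * rearr f (u ^ κ)
      ≤ ENNReal.ofReal u * (rearr f₀ (u ^ κ) + eLpNorm f₁ ∞ μ) := by
        rw [hf]
        gcongr
        exact rearr_add_le f₀ f₁ _
    _ ≤ _ := by
        rw [mul_add]
        exact add_le_add (hweak f₀) le_rfl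

theorem peetreK_lebesgue_le {κ : ℝ} (hκ : 0 < κ) (f : Ω →ₘ[μ] 𝕜) {u : ℝ} (hu : 0 < u) :
    peetreK (Lebesgue μ 𝕜 (ENNReal.ofReal κ)) (Lebesgue μ 𝕜 ∞) u f ≤
      2 * powerMean κ (rearr f) u := by
  have hmul := mul_le_powerMean hκ (rearr_antitone f) hu
  rcases eq_or_ne (powerMean κ (rearr f) u) ∞ with htop | hfin
  · simp [htop]
  obtain ⟨f₀, f₁, hf, h₀, h₁⟩ := exists_add_eq_and_eLpNorm_le hκ f u
  have hf₁ : eLpNorm f₁ ∞ μ < ∞ := h₁.trans_lt <|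
    ENNReal.lt_top_of_mul_ne_top_right (ne_top_of_le_ne_top hfin hmul) (by simpa using hu)
  calc peetreK (Lebesgue μ 𝕜 (ENNReal.ofReal κ)) (Lebesgue μ 𝕜 ∞) u f
      ≤ eLpNorm f₀ (ENNReal.ofReal κ) μ + ENNReal.ofReal u * eLpNorm f₁ ∞ μ :=
        iInf₂_le_of_le f₀ (h₀.trans_lt hfin.lt_top) (iInf₂_le_of_le f₁ hf₁ (iInf_le _ hf))
    _ ≤ 2 * powerMean κ (rearr f) u := by
        rw [two_mul]
        exact add_le_add h₀ ((mul_le_mul_right h₁ _).trans hmul)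

theorem weakLebesgue_qnorm_le_eLpNorm {κ : ℝ} (hκ : 0 < κ) (f : Ω →ₘ[μ] 𝕜) :
    (WeakLebesgue μ 𝕜 (ENNReal.ofReal κ)).qnorm f ≤ eLpNorm f (ENNReal.ofReal κ) μ :=
  iSup₂_le fun t ht => by
    rw [rinv_ofReal hκ.le]
    exact rpow_mul_rearr_le_eLpNorm hκ f ht

end rearr

/-! ### Norms on intervals -/

section normOn

variable {q : ℝ≥0∞} {s : Set ℝ} {f g : ℝ → ℝ≥0∞}

theorem normOn_le_mul (hs : MeasurableSet s) {C : ℝ≥0} (h : ∀ u ∈ s, f u ≤ C * g u) :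
    normOn q s f ≤ C * normOn q s g :=
  eLpNorm_le_nnreal_smul_eLpNorm_of_ae_le_mul' (ae_restrict_of_forall_mem hs h) q

theorem normOn_congr (hs : MeasurableSet s) (h : ∀ u ∈ s, f u = g u) :
    normOn q s f = normOn q s g :=
  eLpNorm_congr_ae (ae_restrict_of_forall_mem hs h)

theorem normOn_mono_set {t : Set ℝ} (h : s ⊆ t) (f : ℝ → ℝ≥0∞) : normOn q s f ≤ normOn q t f :=
  eLpNorm_mono_measure _ (Measure.restrict_mono h le_rfl)

theorem normOn_const_mul (hs : MeasurableSet s) (c : ℝ≥0) (f : ℝ → ℝ≥0∞) :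
    normOn q s (fun u => c * f u) = c * normOn q s f := by
  rcases eq_or_ne c 0 with rfl | hc
  · simp [normOn]
  refine le_antisymm (normOn_le_mul hs fun _ _ => le_rfl) ?_
  rw [ENNReal.mul_le_iff_le_inv (by simpa using hc) ENNReal.coe_ne_top, ← ENNReal.coe_inv hc]
  refine normOn_le_mul hs fun u _ => ?_
  rw [← mul_assoc, ← ENNReal.coe_mul, inv_mul_cancel₀ hc, ENNReal.coe_one, one_mul]

theorem normOn_eq_top (hq : q ≠ 0) (hs : MeasurableSet s) (hs₀ : volume s ≠ 0)
    (h : ∀ u ∈ s, f u = ∞) : normOn q s f = ∞ := by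
  rw [normOn_congr (g := fun _ => ∞) hs h, normOn, eLpNorm_const _ hq (by simpa using hs₀)]
  simp [hs₀]

theorem rinv_eq_inv_toReal (q : ℝ≥0∞) : rinv q = q.toReal⁻¹ := ENNReal.toReal_inv q

theorem eLpNorm_withDensity {α : Type*} [MeasurableSpace α] {μ : Measure α} {w : α → ℝ≥0∞}
    (hw : AEMeasurable w μ) (hw₀ : ∀ᵐ x ∂μ, w x ≠ 0) (hw₁ : ∀ᵐ x ∂μ, w x < ∞) (f : α → ℝ≥0∞) :
    eLpNorm f q (μ.withDensity w) = eLpNorm (fun x => w x ^ rinv q * f x) q μ := by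
  rcases eq_or_ne q 0 with rfl | hq₀
  · simp
  rcases eq_or_ne q ∞ with rfl | hq
  · have hae : ae (μ.withDensity w) = ae μ :=
      le_antisymm (withDensity_absolutelyContinuous μ w).ae_le
        (withDensity_absolutelyContinuous' hw hw₀).ae_le
    simp [rinv, eLpNormEssSup, essSup, hae]
  · have hqp : 0 < q.toReal := ENNReal.toReal_pos hq₀ hq
    rw [eLpNorm_eq_lintegral_rpow_enorm_toReal hq₀ hq,
      eLpNorm_eq_lintegral_rpow_enorm_toReal hq₀ hq,
      lintegral_withDensity_eq_lintegral_mul_non_measurable₀ _ hw hw₁]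
    simp only [enorm_eq_self, Pi.mul_apply, ENNReal.mul_rpow_of_nonneg _ _ hqp.le,
      rinv_eq_inv_toReal, ENNReal.rpow_inv_rpow hqp.ne']

theorem map_exp_volume : Measure.map Real.exp volume =
    (volume.restrict (Ioi 0)).withDensity fun u => ENNReal.ofReal u⁻¹ := by
  ext s hs
  have himg : s ∩ Ioi 0 = Real.exp '' (Real.exp ⁻¹' s) := by
    rw [image_preimage_eq_inter_range, Real.range_exp]
  have hderiv : ∀ x ∈ Real.exp ⁻¹' s, HasDerivWithinAt Real.exp (Real.exp x) (Real.exp ⁻¹' s) x :=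
    fun x _ => (Real.hasDerivAt_exp x).hasDerivWithinAt
  rw [Measure.map_apply Real.measurable_exp hs, withDensity_apply _ hs,
    Measure.restrict_restrict hs, himg, lintegral_image_eq_lintegral_abs_deriv_mul
      (Real.measurable_exp hs) hderiv Real.exp_injective.injOn, ← setLIntegral_one]
  refine lintegral_congr fun x => ?_
  rw [← ENNReal.ofReal_mul (abs_nonneg _), Real.abs_exp, mul_inv_cancel₀ (Real.exp_ne_zero x),
    ENNReal.ofReal_one]

theorem normOn_rpow_neg_rinv_mul (hs : MeasurableSet s) (hs₀ : s ⊆ Ioi 0) (F : ℝ → ℝ≥0∞) :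
    normOn q s (fun u => ENNReal.ofReal (u ^ (-rinv q)) * F u) =
      eLpNorm (F ∘ Real.exp) q (volume.restrict (Real.exp ⁻¹' s)) := by
  have hexp := Real.isOpenEmbedding_exp.measurableEmbedding
  rw [← hexp.eLpNorm_map_measure, ← hexp.restrict_map, map_exp_volume, restrict_withDensity hs,
    Measure.restrict_restrict hs, inter_eq_left.2 hs₀, eLpNorm_withDensity (by fun_prop)
      (ae_restrict_of_forall_mem hs fun u hu => by simpa using hs₀ hu) (.of_forall (by simp))]
  refine normOn_congr hs fun u hu => ?_
  have hu₀ : 0 < u := hs₀ hu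
  rw [ENNReal.ofReal_rpow_of_pos (inv_pos.2 hu₀), Real.inv_rpow hu₀.le, Real.rpow_neg hu₀.le]

theorem map_affine_volume {k : ℝ} (hk : 0 < k) (d : ℝ) :
    Measure.map (fun x => k * x + d) volume = ENNReal.ofReal k⁻¹ • (volume : Measure ℝ) := by
  rw [show (fun x => k * x + d) = (· + d) ∘ (k * ·) from rfl,
    ← Measure.map_map (by fun_prop) (by fun_prop), Real.map_volume_mul_left hk.ne',
    Measure.map_smul, map_add_right_eq_self, abs_of_pos (inv_pos.2 hk)]

theorem normOn_comp_mul_rpow {c k : ℝ} (hc : 0 < c) (hk : 0 < k) (hs : MeasurableSet s)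
    (hs₀ : s ⊆ Ioi 0) (F : ℝ → ℝ≥0∞) :
    normOn q s (fun u => ENNReal.ofReal (u ^ (-rinv q)) * F u) = ENNReal.ofReal (k ^ rinv q) *
      normOn q (Ioi 0 ∩ (fun v => c * v ^ k) ⁻¹' s)
        fun v => ENNReal.ofReal (v ^ (-rinv q)) * F (c * v ^ k) := by
  set A : ℝ → ℝ := fun x => k * x + Real.log c
  have hA : MeasurableEmbedding A :=
    ((Homeomorph.mulLeft₀ k hk.ne').trans (Homeomorph.addRight _)).measurableEmbedding
  have hexp : ∀ x, c * Real.exp x ^ k = Real.exp (A x) := fun x => by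
    rw [Real.exp_add, Real.exp_log hc, mul_comm k, Real.exp_mul, mul_comm]
  have hpre : Real.exp ⁻¹' (Ioi 0 ∩ (fun v => c * v ^ k) ⁻¹' s) = A ⁻¹' (Real.exp ⁻¹' s) := by
    ext x
    simp [hexp, Real.exp_pos]
  have hcomp : (fun v => F (c * v ^ k)) ∘ Real.exp = (F ∘ Real.exp) ∘ A :=
    funext fun x => congrArg F (hexp x)
  rw [normOn_rpow_neg_rinv_mul (measurableSet_Ioi.inter (hs.preimage (by fun_prop)))
      inter_subset_left, normOn_rpow_neg_rinv_mul hs hs₀, hpre, hcomp, ← hA.eLpNorm_map_measure,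
    ← hA.restrict_map, map_affine_volume hk, Measure.restrict_smul,
    eLpNorm_smul_measure_of_ne_zero (by simpa using hk), smul_eq_mul, ← mul_assoc,
    one_div, ← rinv, ENNReal.ofReal_rpow_of_pos (inv_pos.2 hk),
    ← ENNReal.ofReal_mul (by positivity), ← Real.mul_rpow hk.le (inv_pos.2 hk).le,
    mul_inv_cancel₀ hk.ne', Real.one_rpow, ENNReal.ofReal_one, one_mul]

theorem ofReal_rpow_sub_mul {σ τ u : ℝ} (hu : 0 < u) (x : ℝ) :
    ENNReal.ofReal (u ^ (σ - τ) * x) =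
      ENNReal.ofReal (u ^ (-τ)) * ENNReal.ofReal (u ^ σ * x) := by
  rw [← ENNReal.ofReal_mul (by positivity), ← mul_assoc, ← Real.rpow_add hu, neg_add_eq_sub]

end normOn

/-! ### A Hardy-type inequality -/

section geometric

variable {α : Type*} [MeasurableSpace α] {μ : Measure α} {q ρ : ℝ≥0∞}

theorem tsum_rpow_le_of_le_geometric {p : ℝ} (hp : 0 < p) {x : ℕ → ℝ≥0∞} {M : ℝ≥0∞}
    (h : ∀ n, x n ≤ ρ ^ n * M) : ∑' n, x n ^ p ≤ (1 - ρ ^ p)⁻¹ * M ^ p := by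
  rw [← ENNReal.tsum_geometric, ← ENNReal.tsum_mul_right]
  refine ENNReal.tsum_le_tsum fun n => (ENNReal.rpow_le_rpow (h n) hp.le).trans_eq ?_
  rw [ENNReal.mul_rpow_of_nonneg _ _ hp.le, ← ENNReal.rpow_natCast, ← ENNReal.rpow_mul,
    mul_comm (n : ℝ), ENNReal.rpow_mul, ENNReal.rpow_natCast]

theorem tsum_rpow_rpow_inv_le_of_le_geometric {p : ℝ} (hp : 0 < p) {x : ℕ → ℝ≥0∞} {M : ℝ≥0∞}
    (h : ∀ n, x n ≤ ρ ^ n * M) :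
    (∑' n, x n ^ p) ^ p⁻¹ ≤ (1 - ρ ^ p)⁻¹ ^ p⁻¹ * M := by
  refine (ENNReal.rpow_le_rpow (tsum_rpow_le_of_le_geometric hp h) (inv_nonneg.2 hp.le)).trans_eq ?_
  rw [ENNReal.mul_rpow_of_nonneg _ _ (inv_nonneg.2 hp.le), ENNReal.rpow_rpow_inv hp.ne']

theorem eLpNorm_iSup_le_tsum (hq₀ : q ≠ 0) (hq : q ≠ ∞) {F : ℕ → α → ℝ≥0∞}
    (hF : ∀ n, AEMeasurable (F n) μ) :
    eLpNorm (fun x => ⨆ n, F n x) q μ ≤ (∑' n, eLpNorm (F n) q μ ^ q.toReal) ^ q.toReal⁻¹ := by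
  have hqp : 0 < q.toReal := ENNReal.toReal_pos hq₀ hq
  have hnorm : ∀ f : α → ℝ≥0∞, eLpNorm f q μ = (∫⁻ x, f x ^ q.toReal ∂μ) ^ q.toReal⁻¹ := fun f => by
    simp [eLpNorm_eq_lintegral_rpow_enorm_toReal hq₀ hq]
  simp only [hnorm, ENNReal.rpow_inv_rpow hqp.ne']
  rw [← lintegral_tsum fun n => (hF n).pow_const _]
  gcongr with x
  rw [← ENNReal.le_rpow_inv_iff hqp]
  exact iSup_le fun n => (ENNReal.le_rpow_inv_iff hqp).2 (ENNReal.le_tsum n)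

theorem eLpNorm_top_iSup_le {F : ℕ → α → ℝ≥0∞} {A : ℝ≥0∞} (h : ∀ n, eLpNorm (F n) ∞ μ ≤ A) :
    eLpNorm (fun x => ⨆ n, F n x) ∞ μ ≤ A := by
  refine eLpNormEssSup_le_of_ae_enorm_bound ?_
  filter_upwards [ae_all_iff.2 fun n => ae_le_eLpNormEssSup (f := F n) (μ := μ)] with x hx
  exact iSup_le fun n => (hx n).trans (h n)

theorem exists_eLpNorm_iSup_le (q : ℝ≥0∞) (hρ : ρ < 1) :
    ∃ C : ℝ≥0, ∀ (μ : Measure α) (F : ℕ → α → ℝ≥0∞) (A : ℝ≥0∞), (∀ n, AEMeasurable (F n) μ) →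
      (∀ n, eLpNorm (F n) q μ ≤ ρ ^ n * A) → eLpNorm (fun x => ⨆ n, F n x) q μ ≤ C * A := by
  rcases eq_or_ne q 0 with rfl | hq₀
  · exact ⟨0, by simp⟩
  rcases eq_or_ne q ∞ with rfl | hq
  · refine ⟨1, fun μ F A _ h => ?_⟩
    rw [ENNReal.coe_one, one_mul]
    exact eLpNorm_top_iSup_le fun n => (h n).trans (mul_le_of_le_one_left' (pow_le_one' hρ.le n))
  have hqp : 0 < q.toReal := ENNReal.toReal_pos hq₀ hq
  have hC : (1 - ρ ^ q.toReal)⁻¹ ^ q.toReal⁻¹ ≠ ∞ :=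
    ENNReal.rpow_ne_top_of_nonneg (inv_nonneg.2 hqp.le) <|
      ENNReal.inv_ne_top.2 (tsub_pos_of_lt (ENNReal.rpow_lt_one hρ hqp)).ne'
  refine ⟨((1 - ρ ^ q.toReal)⁻¹ ^ q.toReal⁻¹).toNNReal, fun μ F A hF h => ?_⟩
  rw [ENNReal.coe_toNNReal hC]
  exact (eLpNorm_iSup_le_tsum hq₀ hq hF).trans (tsum_rpow_rpow_inv_le_of_le_geometric hqp h)

end geometric

section hardy

variable {κ : ℝ} {h : ℝ → ℝ≥0∞} {u : ℝ}

theorem Ioo_subset_iUnion_dyadic (hκ : 0 < κ) (hu : 0 < u) :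
    Ioo 0 (u ^ κ) ⊆ ⋃ n : ℕ, Ioc ((u / 2 ^ (n + 1)) ^ κ) ((u / 2 ^ n) ^ κ) := by
  rintro v ⟨hv, hvu⟩
  have hw : 0 < v ^ κ⁻¹ := Real.rpow_pos_of_pos hv _
  have hx : 1 < u / v ^ κ⁻¹ := by
    rwa [one_lt_div hw, Real.rpow_inv_lt_iff_of_pos hv.le hu.le hκ]
  obtain ⟨n, hn, hn'⟩ := exists_nat_pow_near hx.le one_lt_two
  refine mem_iUnion.2 ⟨n, ?_, ?_⟩
  · rwa [← Real.lt_rpow_inv_iff_of_pos (by positivity) hv.le hκ, div_lt_comm₀ (by positivity) hw]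
  · rwa [← Real.rpow_inv_le_iff_of_pos hv.le (by positivity) hκ, le_div_comm₀ hw (by positivity)]

theorem powerMean_le_tsum (hκ : 0 < κ) (hh : Antitone h) (hu : 0 < u) :
    powerMean κ h u ≤ 2 * (∑' n : ℕ,
      (ENNReal.ofReal (u / 2 ^ (n + 1)) * h ((u / 2 ^ (n + 1)) ^ κ)) ^ κ) ^ κ⁻¹ := by
  have hblock : ∀ n : ℕ, ∫⁻ v in Ioc ((u / 2 ^ (n + 1)) ^ κ) ((u / 2 ^ n) ^ κ), h v ^ κ ≤
      2 ^ κ * (ENNReal.ofReal (u / 2 ^ (n + 1)) * h ((u / 2 ^ (n + 1)) ^ κ)) ^ κ := fun n => by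
    have hvol : volume (Ioc ((u / 2 ^ (n + 1)) ^ κ) ((u / 2 ^ n) ^ κ)) ≤
        (2 * ENNReal.ofReal (u / 2 ^ (n + 1))) ^ κ := by
      rw [Real.volume_Ioc, ← ENNReal.ofReal_ofNat, ← ENNReal.ofReal_mul zero_le_two,
        ENNReal.ofReal_rpow_of_pos (by positivity)]
      refine ENNReal.ofReal_le_ofReal ((sub_le_self _ (by positivity)).trans_eq ?_)
      rw [pow_succ]
      congr 1
      field_simp
    calc _ ≤ ∫⁻ _ in Ioc ((u / 2 ^ (n + 1)) ^ κ) ((u / 2 ^ n) ^ κ),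
          h ((u / 2 ^ (n + 1)) ^ κ) ^ κ :=
          setLIntegral_mono' measurableSet_Ioc fun v hv => ENNReal.rpow_le_rpow (hh hv.1.le) hκ.le
      _ ≤ h ((u / 2 ^ (n + 1)) ^ κ) ^ κ * (2 * ENNReal.ofReal (u / 2 ^ (n + 1))) ^ κ := by
          rw [setLIntegral_const]
          gcongr
      _ = _ := by
          rw [← ENNReal.mul_rpow_of_nonneg _ _ hκ.le, ← ENNReal.mul_rpow_of_nonneg _ _ hκ.le,
            mul_comm, mul_assoc]
  rw [powerMean, ENNReal.rpow_inv_le_iff hκ, ENNReal.mul_rpow_of_nonneg _ _ hκ.le,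
    ENNReal.rpow_inv_rpow hκ.ne', ← ENNReal.tsum_mul_left]
  calc ∫⁻ v in Ioo 0 (u ^ κ), h v ^ κ
      ≤ ∫⁻ v in ⋃ n : ℕ, Ioc ((u / 2 ^ (n + 1)) ^ κ) ((u / 2 ^ n) ^ κ), h v ^ κ :=
        lintegral_mono_set (Ioo_subset_iUnion_dyadic hκ hu)
    _ ≤ _ := (lintegral_iUnion_le _ _).trans (ENNReal.tsum_le_tsum hblock)

theorem powerMean_le_iSup {ρ : ℝ≥0∞} (hρ₀ : ρ ≠ 0) (hρ : ρ < 1) (hκ : 0 < κ) (hh : Antitone h)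
    (hu : 0 < u) :
    powerMean κ h u ≤ 2 * (1 - ρ ^ κ)⁻¹ ^ κ⁻¹ *
      ⨆ n : ℕ, (ρ ^ n)⁻¹ * (ENNReal.ofReal (u / 2 ^ (n + 1)) * h ((u / 2 ^ (n + 1)) ^ κ)) := by
  refine (powerMean_le_tsum hκ hh hu).trans ?_
  rw [mul_assoc]
  gcongr
  refine tsum_rpow_rpow_inv_le_of_le_geometric hκ fun n => ?_
  have hρn : ρ ^ n ≠ 0 := pow_ne_zero n hρ₀
  rw [← ENNReal.inv_mul_le_iff hρn (ENNReal.pow_ne_top hρ.ne_top)]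
  exact le_iSup (fun n : ℕ =>
    (ρ ^ n)⁻¹ * (ENNReal.ofReal (u / 2 ^ (n + 1)) * h ((u / 2 ^ (n + 1)) ^ κ))) n

end hardy

/-- `a` is a weight on `(0, ∞)` of upper type `ε`: it grows at most like `l ^ ε` under dilation by
`l ≥ 1`. Slowly varying functions are of every positive upper type. As in `SlowlyVarying`, only the
values of `a` on `(0, ∞)` matter. -/
structure UpperType (ε : ℝ) (a : ℝ → ℝ) : Prop where
  aemeasurable : AEMeasurable a (volume.restrict (Ioi 0))
  pos : ∀ t ∈ Ioi (0 : ℝ), 0 < a t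
  exists_dilate_le : ∃ C : ℝ≥0, ∀ l v : ℝ, 1 ≤ l → 0 < v → a (l * v) ≤ C * l ^ ε * a v

namespace UpperType

variable {a : ℝ → ℝ} {ε θ κ : ℝ}

theorem aemeasurable_rpow_mul (ha : UpperType ε a) (σ T : ℝ) :
    AEMeasurable (fun u => ENNReal.ofReal (u ^ σ * a u)) (volume.restrict (Ioo 0 T)) :=
  have haT : AEMeasurable a (volume.restrict (Ioo 0 T)) :=
    ha.aemeasurable.mono_measure (Measure.restrict_mono Ioo_subset_Ioi_self le_rfl)
  ((by fun_prop : Measurable fun u : ℝ => u ^ σ).aemeasurable.mul haT).ennreal_ofReal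

theorem exists_normOn_dilate_le (ha : UpperType ε a) (θ : ℝ) (q : ℝ≥0∞) :
    ∃ C : ℝ≥0, ∀ (G : ℝ → ℝ≥0∞) (T l : ℝ), 1 ≤ l →
      normOn q (Ioo 0 T) (fun u => ENNReal.ofReal (u ^ (-θ - rinv q) * a u) * G (u / l)) ≤
        C * ENNReal.ofReal (l ^ (ε - θ)) *
          normOn q (Ioo 0 T) (fun u => ENNReal.ofReal (u ^ (-θ - rinv q) * a u) * G u) := by
  obtain ⟨C, hC⟩ := ha.exists_dilate_le
  refine ⟨C, fun G T l hl => ?_⟩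
  have hl₀ : 0 < l := by positivity
  have hsub : Ioi 0 ∩ (fun v => l * v ^ (1 : ℝ)) ⁻¹' Ioo 0 T ⊆ Ioo 0 T := fun v ⟨hv, hvT⟩ =>
    ⟨hv, (le_mul_of_one_le_left (le_of_lt hv) hl).trans_lt (by simpa using hvT.2)⟩
  have hweight : ∀ v : ℝ, 0 < v → ENNReal.ofReal ((l * v) ^ (-θ) * a (l * v)) ≤
      C * ENNReal.ofReal (l ^ (ε - θ)) * ENNReal.ofReal (v ^ (-θ) * a v) := fun v hv => by
    rw [← ENNReal.ofReal_coe_nnreal, ← ENNReal.ofReal_mul (by positivity),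
      ← ENNReal.ofReal_mul (by positivity)]
    refine ENNReal.ofReal_le_ofReal ?_
    calc (l * v) ^ (-θ) * a (l * v) ≤ (l * v) ^ (-θ) * (C * l ^ ε * a v) := by
          gcongr
          exact hC l v hl hv
      _ = C * l ^ (ε - θ) * (v ^ (-θ) * a v) := by
          rw [Real.mul_rpow hl₀.le hv.le, sub_eq_neg_add, Real.rpow_add hl₀]
          ring
  calc normOn q (Ioo 0 T) (fun u => ENNReal.ofReal (u ^ (-θ - rinv q) * a u) * G (u / l))
      = normOn q (Ioo 0 T) (fun u => ENNReal.ofReal (u ^ (-rinv q)) *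
          (ENNReal.ofReal (u ^ (-θ) * a u) * G (u / l))) :=
        normOn_congr measurableSet_Ioo fun u hu => by rw [ofReal_rpow_sub_mul hu.1, mul_assoc]
    _ = normOn q (Ioi 0 ∩ (fun v => l * v ^ (1 : ℝ)) ⁻¹' Ioo 0 T) (fun v =>
          ENNReal.ofReal (v ^ (-rinv q)) *
            (ENNReal.ofReal ((l * v) ^ (-θ) * a (l * v)) * G v)) := by
        rw [normOn_comp_mul_rpow hl₀ one_pos measurableSet_Ioo Ioo_subset_Ioi_self]
        simp [mul_div_cancel_left₀ _ hl₀.ne']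
    _ ≤ normOn q (Ioo 0 T) (fun v => ENNReal.ofReal (v ^ (-rinv q)) *
          (ENNReal.ofReal ((l * v) ^ (-θ) * a (l * v)) * G v)) := normOn_mono_set hsub _
    _ ≤ _ := by
        rw [← ENNReal.coe_toNNReal (a := ENNReal.ofReal _) ENNReal.ofReal_ne_top, ← ENNReal.coe_mul]
        refine normOn_le_mul measurableSet_Ioo fun v hv => ?_
        rw [ENNReal.coe_mul, ENNReal.coe_toNNReal ENNReal.ofReal_ne_top,
          ofReal_rpow_sub_mul hv.1, ← mul_assoc, ← mul_assoc, mul_left_comm]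
        gcongr
        exact hweight v hv.1

theorem exists_normOn_dyadic_le (ha : UpperType ε a) (hεθ : ε < θ) (q : ℝ≥0∞) :
    ∃ ρ : ℝ≥0, ρ ≠ 0 ∧ ρ < 1 ∧ ∃ C : ℝ≥0, ∀ (G : ℝ → ℝ≥0∞) (T : ℝ) (n : ℕ),
      normOn q (Ioo 0 T) (fun u => ENNReal.ofReal (u ^ (-θ - rinv q) * a u) *
          ((ρ ^ n : ℝ≥0∞)⁻¹ * G (u / 2 ^ (n + 1)))) ≤
        ρ ^ n * (C * normOn q (Ioo 0 T)
          fun u => ENNReal.ofReal (u ^ (-θ - rinv q) * a u) * G u) := by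
  obtain ⟨C, hC⟩ := ha.exists_normOn_dilate_le θ q
  set ρ : ℝ≥0 := 2 ^ ((ε - θ) / 2)
  have hρ₀ : ρ ≠ 0 := by simp [ρ]
  have hρ : ρ < 1 := NNReal.rpow_lt_one_of_one_lt_of_neg one_lt_two (by linarith)
  have hpow : ∀ n : ℕ, ENNReal.ofReal ((2 ^ (n + 1)) ^ (ε - θ)) = (ρ ^ (n + 1)) ^ 2 := fun n => by
    have hreal : ((2 : ℝ) ^ (n + 1)) ^ (ε - θ) = ((ρ : ℝ) ^ (n + 1)) ^ 2 := by
      rw [NNReal.coe_rpow, NNReal.coe_ofNat, ← Real.rpow_natCast_mul zero_le_two, ← pow_mul,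
        ← Real.rpow_mul_natCast zero_le_two]
      push_cast
      ring_nf
    rw [hreal, ← NNReal.coe_pow, ← NNReal.coe_pow, ENNReal.ofReal_coe_nnreal, ENNReal.coe_pow,
      ENNReal.coe_pow]
  refine ⟨ρ, hρ₀, hρ, C, fun G T n => ?_⟩
  set N := normOn q (Ioo 0 T) fun u => ENNReal.ofReal (u ^ (-θ - rinv q) * a u) * G u
  have hρn : (ρ : ℝ≥0∞) ^ n ≠ 0 := by simpa using fun h => absurd h hρ₀
  calc _ ≤ ((ρ ^ n)⁻¹ : ℝ≥0) * normOn q (Ioo 0 T)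
          (fun u => ENNReal.ofReal (u ^ (-θ - rinv q) * a u) * G (u / 2 ^ (n + 1))) :=
        normOn_le_mul measurableSet_Ioo fun u _ => by
          rw [mul_left_comm, ENNReal.coe_inv (pow_ne_zero n hρ₀), ENNReal.coe_pow]
    _ ≤ (ρ ^ n : ℝ≥0∞)⁻¹ * (C * (ρ ^ (n + 1)) ^ 2 * N) := by
        rw [← hpow, ENNReal.coe_inv (pow_ne_zero n hρ₀), ENNReal.coe_pow]
        gcongr
        exact hC G T _ (one_le_pow₀ one_le_two)
    _ = (ρ ^ n : ℝ≥0∞)⁻¹ * ρ ^ n * (ρ ^ 2 * (ρ ^ n * (C * N))) := by ring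
    _ ≤ ρ ^ n * (C * N) := by
        rw [ENNReal.inv_mul_cancel hρn (by finiteness), one_mul]
        exact mul_le_of_le_one_left' (pow_le_one' (by exact_mod_cast hρ.le) 2)

theorem exists_normOn_powerMean_le (ha : UpperType ε a) (hεθ : ε < θ) (hκ : 0 < κ) (q : ℝ≥0∞) :
    ∃ C : ℝ≥0, ∀ h : ℝ → ℝ≥0∞, Antitone h → ∀ T : ℝ,
      normOn q (Ioo 0 T) (fun u => ENNReal.ofReal (u ^ (-θ - rinv q) * a u) * powerMean κ h u) ≤
        C * normOn q (Ioo 0 T) fun u =>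
          ENNReal.ofReal (u ^ (-θ - rinv q) * a u) * (ENNReal.ofReal u * h (u ^ κ)) := by
  obtain ⟨ρ, hρ₀, hρ, C₁, hC₁⟩ := ha.exists_normOn_dyadic_le hεθ q
  have hρ' : (ρ : ℝ≥0∞) < 1 := by exact_mod_cast hρ
  obtain ⟨C₂, hC₂⟩ := exists_eLpNorm_iSup_le (α := ℝ) q hρ'
  have hfin : 2 * (1 - (ρ : ℝ≥0∞) ^ κ)⁻¹ ^ κ⁻¹ ≠ ∞ :=
    ENNReal.mul_ne_top ENNReal.ofNat_ne_top <| ENNReal.rpow_ne_top_of_nonneg (inv_nonneg.2 hκ.le) <|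
      ENNReal.inv_ne_top.2 (tsub_pos_of_lt (ENNReal.rpow_lt_one hρ' hκ)).ne'
  obtain ⟨C₃, hC₃⟩ : ∃ C₃ : ℝ≥0, C₃ = 2 * (1 - (ρ : ℝ≥0∞) ^ κ)⁻¹ ^ κ⁻¹ :=
    ⟨_, ENNReal.coe_toNNReal hfin⟩
  refine ⟨C₃ * (C₂ * C₁), fun h hh T => ?_⟩
  set w : ℝ → ℝ≥0∞ := fun u => ENNReal.ofReal (u ^ (-θ - rinv q) * a u)
  set G : ℝ → ℝ≥0∞ := fun u => ENNReal.ofReal u * h (u ^ κ)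
  have hG : Measurable G := ENNReal.measurable_ofReal.mul (hh.measurable.comp (by fun_prop))
  set F : ℕ → ℝ → ℝ≥0∞ := fun n u => w u * ((ρ ^ n : ℝ≥0∞)⁻¹ * G (u / 2 ^ (n + 1)))
  have hF : ∀ n, AEMeasurable (F n) (volume.restrict (Ioo 0 T)) := fun n =>
    (ha.aemeasurable_rpow_mul _ T).mul
      ((hG.comp (measurable_id.div_const _)).const_mul _).aemeasurable
  calc normOn q (Ioo 0 T) (fun u => w u * powerMean κ h u)
      ≤ C₃ * normOn q (Ioo 0 T) (fun u => ⨆ n, F n u) :=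
        normOn_le_mul measurableSet_Ioo fun u hu => by
          rw [← ENNReal.mul_iSup, mul_left_comm, hC₃]
          gcongr
          exact powerMean_le_iSup (by simpa using hρ₀) hρ' hκ hh hu.1
    _ ≤ C₃ * (C₂ * (C₁ * normOn q (Ioo 0 T) fun u => w u * G u)) := by
        gcongr
        exact hC₂ _ F _ hF (hC₁ G T)
    _ = _ := by
        push_cast
        ring

end UpperType

theorem SlowlyVarying.upperType {a : ℝ → ℝ} {ε : ℝ} (ha : SlowlyVarying a) (hε : 0 < ε) :
    UpperType ε a where
  aemeasurable := ha.aemeasurable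
  pos := ha.pos
  exists_dilate_le := by
    obtain ⟨g, -, hg, c, C, hc, hC, h⟩ := ha.equiv_anti ε hε
    refine ⟨(C / c).toNNReal, fun l v hl hv => ?_⟩
    have hl₀ : 0 < l := one_pos.trans_le hl
    have hlv : 0 < l * v := mul_pos hl₀ hv
    have hequiv : (l * v) ^ (-ε) * a (l * v) ≤ C / c * (v ^ (-ε) * a v) :=
      calc (l * v) ^ (-ε) * a (l * v) ≤ C * g (l * v) := (h _ hlv).2
        _ ≤ C * g v := by
            gcongr
            exact hg hv hlv (le_mul_of_one_le_left hv.le hl)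
        _ = C / c * (c * g v) := by field_simp
        _ ≤ C / c * (v ^ (-ε) * a v) := mul_le_mul_of_nonneg_left (h v hv).1 (by positivity)
    rw [Real.mul_rpow hl₀.le hv.le] at hequiv
    rw [Real.coe_toNNReal _ (by positivity)]
    calc a (l * v) = l ^ ε * v ^ ε * (l ^ (-ε) * v ^ (-ε) * a (l * v)) := by
          rw [Real.rpow_neg hl₀.le, Real.rpow_neg hv.le]
          field_simp
      _ ≤ l ^ ε * v ^ ε * (C / c * (v ^ (-ε) * a v)) := by gcongr
      _ = C / c * l ^ ε * a v := by
          rw [Real.rpow_neg hv.le]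
          field_simp

theorem upperType_one : UpperType 0 fun _ => 1 where
  aemeasurable := aemeasurable_const
  pos _ _ := one_pos
  exists_dilate_le := ⟨1, by simp⟩

/-! ### Iterated norms -/

section leftNorm

variable {σ : ℝ} {r q : ℝ≥0∞} {a b : ℝ → ℝ} {g g' : ℝ → ℝ≥0∞}

theorem leftNorm_le_mul_of_normOn_le {C : ℝ≥0}
    (h : ∀ t, normOn q (Ioo 0 t) (fun u => ENNReal.ofReal (u ^ (σ - rinv q) * a u) * g u) ≤
      C * normOn q (Ioo 0 t) fun u => ENNReal.ofReal (u ^ (σ - rinv q) * a u) * g' u) :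
    leftNorm σ r b q a g ≤ C * leftNorm σ r b q a g' :=
  normOn_le_mul measurableSet_Ioi fun t _ => by
    rw [mul_left_comm]
    exact mul_le_mul_right (h t) _

theorem leftNorm_le_mul {C : ℝ≥0} (h : ∀ u, 0 < u → g u ≤ C * g' u) :
    leftNorm σ r b q a g ≤ C * leftNorm σ r b q a g' :=
  leftNorm_le_mul_of_normOn_le fun t => normOn_le_mul measurableSet_Ioo fun u hu => by
    rw [mul_left_comm]
    exact mul_le_mul_right (h u hu.1) _

theorem exists_lt_top_of_leftNorm_lt_top (hq : 0 < q) (hr : 0 < r)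
    (ha : ∀ t ∈ Ioi (0 : ℝ), 0 < a t) (hb : ∀ t ∈ Ioi (0 : ℝ), 0 < b t)
    (h : leftNorm σ r b q a g < ∞) : ∃ u, 0 < u ∧ g u < ∞ := by
  by_contra! hg
  have hweight : ∀ {c : ℝ → ℝ} (τ : ℝ) {t : ℝ}, 0 < t → 0 < c t →
      ENNReal.ofReal (t ^ τ * c t) ≠ 0 := fun τ t ht hc => by
    simpa using mul_pos (Real.rpow_pos_of_pos ht τ) hc
  have hinner : ∀ t : ℝ, 0 < t →
      normOn q (Ioo 0 t) (fun u => ENNReal.ofReal (u ^ (σ - rinv q) * a u) * g u) = ∞ :=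
    fun t ht => normOn_eq_top hq.ne' measurableSet_Ioo (by simpa using ht) fun u hu => by
      rw [top_le_iff.1 (hg u hu.1), ENNReal.mul_top (hweight _ hu.1 (ha u hu.1))]
  refine h.ne (normOn_eq_top hr.ne' measurableSet_Ioi (by simp) fun t ht => ?_)
  rw [hinner t ht, ENNReal.mul_top (hweight _ ht (hb t ht))]

theorem normOn_Ioo_rpow {κ t : ℝ} (hκ : 0 < κ) (ht : 0 < t) (θ : ℝ) (q : ℝ≥0∞) (a : ℝ → ℝ)
    (h : ℝ → ℝ≥0∞) :
    normOn q (Ioo 0 (t ^ κ)) (fun u =>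
        ENNReal.ofReal (u ^ ((1 - θ) / κ - rinv q) * a (u ^ (1 / κ))) * h u) =
      ENNReal.ofReal (κ ^ rinv q) * normOn q (Ioo 0 t) (fun u =>
        ENNReal.ofReal (u ^ (-θ - rinv q) * a u) * (ENNReal.ofReal u * h (u ^ κ))) := by
  have hpre : Ioi 0 ∩ (fun v => 1 * v ^ κ) ⁻¹' Ioo 0 (t ^ κ) = Ioo 0 t := by
    ext v
    refine ⟨fun ⟨hv, hvt⟩ => ⟨hv, ?_⟩, fun ⟨hv, hvt⟩ => ⟨hv, ?_⟩⟩
    · exact (Real.rpow_lt_rpow_iff (le_of_lt hv) ht.le hκ).1 (by simpa using hvt.2)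
    · simpa using ⟨Real.rpow_pos_of_pos hv κ, Real.rpow_lt_rpow hv.le hvt hκ⟩
  rw [normOn_congr measurableSet_Ioo (g := fun u => ENNReal.ofReal (u ^ (-rinv q)) *
      (ENNReal.ofReal (u ^ ((1 - θ) / κ) * a (u ^ (1 / κ))) * h u))
      fun u hu => by rw [ofReal_rpow_sub_mul hu.1, mul_assoc],
    normOn_comp_mul_rpow one_pos hκ measurableSet_Ioo Ioo_subset_Ioi_self, hpre]
  congr 1
  refine normOn_congr measurableSet_Ioo fun v ⟨hv, _⟩ => ?_
  rw [ofReal_rpow_sub_mul hv, mul_assoc, one_mul, one_div, Real.rpow_rpow_inv hv.le hκ.ne',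
    ← Real.rpow_mul hv.le, mul_div_cancel₀ _ hκ.ne', sub_eq_neg_add, Real.rpow_add hv,
    Real.rpow_one, mul_right_comm, ENNReal.ofReal_mul' hv.le, mul_assoc]

theorem leftNorm_rpow {κ : ℝ} (hκ : 0 < κ) (θ : ℝ) (r q : ℝ≥0∞) (a b : ℝ → ℝ) (h : ℝ → ℝ≥0∞) :
    leftNorm ((1 - θ) / κ) r (fun t => b (t ^ (1 / κ))) q (fun t => a (t ^ (1 / κ))) h =
      (κ ^ rinv r * κ ^ rinv q).toNNReal *
        leftNorm (-θ) r b q a fun u => ENNReal.ofReal u * h (u ^ κ) := by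
  have hpre : Ioi 0 ∩ (fun v => 1 * v ^ κ) ⁻¹' Ioi 0 = Ioi (0 : ℝ) :=
    inter_eq_left.2 fun v hv => by simpa using Real.rpow_pos_of_pos hv κ
  rw [leftNorm, leftNorm, normOn_congr measurableSet_Ioi (g := fun t =>
      ENNReal.ofReal (t ^ (-rinv r)) * (ENNReal.ofReal (b (t ^ (1 / κ))) *
        normOn q (Ioo 0 t) fun u =>
          ENNReal.ofReal (u ^ ((1 - θ) / κ - rinv q) * a (u ^ (1 / κ))) * h u))
      fun t ht => by rw [ENNReal.ofReal_mul (Real.rpow_nonneg (le_of_lt ht) _), mul_assoc],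
    normOn_comp_mul_rpow one_pos hκ measurableSet_Ioi subset_rfl, hpre,
    Real.toNNReal_mul (by positivity), ENNReal.coe_mul, mul_assoc,
    ← normOn_const_mul measurableSet_Ioi]
  congr 1
  refine normOn_congr measurableSet_Ioi fun t (ht : 0 < t) => ?_
  rw [one_mul, normOn_Ioo_rpow hκ ht, one_div, Real.rpow_rpow_inv ht.le hκ.ne',
    ENNReal.ofReal_mul (by positivity), mul_left_comm (ENNReal.ofReal (b t)), mul_left_comm,
    ← mul_assoc (ENNReal.ofReal _) (ENNReal.ofReal (b t))]
  rfl

end leftNorm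

/-! ### Identification of the interpolation spaces -/

section FnSpace

variable {V : Type*}

theorem FnSpace.Embeds.trans {X Y Z : FnSpace V} (h : X.Embeds Y) (h' : Y.Embeds Z) :
    X.Embeds Z := by
  obtain ⟨hXY, C, hC⟩ := h
  obtain ⟨hYZ, C', hC'⟩ := h'
  refine ⟨hXY.trans hYZ, C' * C, fun f hf => (hC' f (hXY hf)).trans ?_⟩
  rw [ENNReal.coe_mul, mul_assoc]
  exact mul_le_mul_right (hC f hf) _

theorem FnSpace.ofNorm_embeds_ofNorm {N N' : V → ℝ≥0∞} (C : ℝ≥0) (h : ∀ f, N' f ≤ C * N f) :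
    (FnSpace.ofNorm N).Embeds (.ofNorm N') :=
  ⟨fun f hf => (h f).trans_lt (ENNReal.mul_lt_top ENNReal.coe_lt_top hf), C, fun f _ => h f⟩

variable [AddCommGroup V] {A₀ A₁ : FnSpace V} {θ : ℝ} {r q : ℝ≥0∞} {a b : ℝ → ℝ}

theorem isSum_of_peetreK_lt_top {t : ℝ} {f : V} (h : peetreK A₀ A₁ t f < ∞) : IsSum A₀ A₁ f := by
  simp only [peetreK, iInf_lt_top] at h
  obtain ⟨f₀, h₀, f₁, h₁, hf, -⟩ := h
  exact ⟨f₀, h₀, f₁, h₁, hf⟩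

theorem interpL_eq_ofNorm (hq : 0 < q) (hr : 0 < r) (ha : ∀ t ∈ Ioi (0 : ℝ), 0 < a t)
    (hb : ∀ t ∈ Ioi (0 : ℝ), 0 < b t) :
    interpL A₀ A₁ θ r b q a =
      .ofNorm fun f => leftNorm (-θ) r b q a fun u => peetreK A₀ A₁ u f := by
  refine congrArg (FnSpace.mk · _) (ext fun f => and_iff_right_of_imp fun hf => ?_)
  obtain ⟨u, -, hu⟩ := exists_lt_top_of_leftNorm_lt_top hq hr ha hb hf
  exact isSum_of_peetreK_lt_top hu

theorem FnSpace.Embeds.exists_peetreK_le {B₀ : FnSpace V} (h : A₀.Embeds B₀) :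
    ∃ C : ℝ≥0, ∀ t f, peetreK B₀ A₁ t f ≤ C * peetreK A₀ A₁ t f := by
  obtain ⟨hsub, C, hC⟩ := h
  refine ⟨max 1 C, fun t f => ?_⟩
  have hC₁ : ((max 1 C : ℝ≥0) : ℝ≥0∞) ≠ 0 := by simp
  simp only [peetreK, ENNReal.mul_iInf_of_ne hC₁ ENNReal.coe_ne_top, mul_add]
  refine iInf₂_mono' fun f₀ h₀ => ⟨f₀, hsub h₀, iInf₂_mono fun f₁ _ => iInf_mono fun _ => ?_⟩
  refine add_le_add ((hC f₀ h₀).trans (mul_le_mul_left ?_ _)) (le_mul_of_one_le_left' ?_)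
  · exact_mod_cast le_max_right 1 C
  · exact_mod_cast le_max_left 1 C

end FnSpace

section spaces

variable {Ω : Type*} [MeasurableSpace Ω] (μ : Measure Ω) (𝕜 : Type*) [RCLike 𝕜]
  {ε θ κ : ℝ} {q r : ℝ≥0∞} {a b : ℝ → ℝ}

theorem lebesgue_embeds_weakLebesgue (hκ : 0 < κ) :
    (Lebesgue μ 𝕜 (ENNReal.ofReal κ)).Embeds (WeakLebesgue μ 𝕜 (ENNReal.ofReal κ)) :=
  FnSpace.ofNorm_embeds_ofNorm 1 fun f =>
    (weakLebesgue_qnorm_le_eLpNorm hκ f).trans_eq (by rw [ENNReal.coe_one, one_mul])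

theorem interpL_lebesgue_embeds_interpL_weakLebesgue (hκ : 0 < κ) (hq : 0 < q) (hr : 0 < r)
    (ha : ∀ t ∈ Ioi (0 : ℝ), 0 < a t) (hb : ∀ t ∈ Ioi (0 : ℝ), 0 < b t) :
    (interpL (Lebesgue μ 𝕜 (ENNReal.ofReal κ)) (Lebesgue μ 𝕜 ∞) θ r b q a).Embeds
      (interpL (WeakLebesgue μ 𝕜 (ENNReal.ofReal κ)) (Lebesgue μ 𝕜 ∞) θ r b q a) := by
  obtain ⟨C, hC⟩ := (lebesgue_embeds_weakLebesgue μ 𝕜 hκ).exists_peetreK_le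
  rw [interpL_eq_ofNorm hq hr ha hb, interpL_eq_ofNorm hq hr ha hb]
  exact FnSpace.ofNorm_embeds_ofNorm C fun f => leftNorm_le_mul fun u _ => hC u f

theorem interpL_weakLebesgue_embeds_LKL (hθ : θ ≤ 1) (hκ : 0 < κ) (hq : 0 < q) (hr : 0 < r)
    (ha : ∀ t ∈ Ioi (0 : ℝ), 0 < a t) (hb : ∀ t ∈ Ioi (0 : ℝ), 0 < b t) :
    (interpL (WeakLebesgue μ 𝕜 (ENNReal.ofReal κ)) (Lebesgue μ 𝕜 ∞) θ r b q a).Embeds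
      (LKL μ 𝕜 (ENNReal.ofReal κ / ENNReal.ofReal (1 - θ)) r (fun t => b (t ^ (1 / κ))) q
        fun t => a (t ^ (1 / κ))) := by
  rw [interpL_eq_ofNorm hq hr ha hb]
  refine FnSpace.ofNorm_embeds_ofNorm (κ ^ rinv r * κ ^ rinv q).toNNReal fun f => ?_
  rw [rinv_div hθ hκ, leftNorm_rpow hκ]
  gcongr
  simpa using leftNorm_le_mul (C := 1) fun u hu => by simpa using mul_rearr_le_peetreK hκ f hu

theorem LKL_embeds_interpL_lebesgue (hεθ : ε < θ) (hθ : θ ≤ 1) (hκ : 0 < κ) (hq : 0 < q)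
    (hr : 0 < r) (ha : UpperType ε a) (hb : ∀ t ∈ Ioi (0 : ℝ), 0 < b t) :
    (LKL μ 𝕜 (ENNReal.ofReal κ / ENNReal.ofReal (1 - θ)) r (fun t => b (t ^ (1 / κ))) q
        fun t => a (t ^ (1 / κ))).Embeds
      (interpL (Lebesgue μ 𝕜 (ENNReal.ofReal κ)) (Lebesgue μ 𝕜 ∞) θ r b q a) := by
  rw [interpL_eq_ofNorm hq hr ha.pos hb]
  obtain ⟨C, hC⟩ := ha.exists_normOn_powerMean_le hεθ hκ q
  set c : ℝ≥0 := (κ ^ rinv r * κ ^ rinv q).toNNReal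
  have hc : c ≠ 0 := by simpa [c] using (by positivity : 0 < κ ^ rinv r * κ ^ rinv q)
  refine FnSpace.ofNorm_embeds_ofNorm (2 * C * c⁻¹) fun f => ?_
  rw [rinv_div hθ hκ, leftNorm_rpow hκ, ← mul_assoc, ← ENNReal.coe_mul, inv_mul_cancel_right₀ hc,
    ENNReal.coe_mul, mul_assoc]
  calc leftNorm (-θ) r b q a
        (fun u => peetreK (Lebesgue μ 𝕜 (ENNReal.ofReal κ)) (Lebesgue μ 𝕜 ∞) u f)
      ≤ (2 : ℝ≥0) * leftNorm (-θ) r b q a (powerMean κ (rearr f)) :=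
        leftNorm_le_mul fun u hu => peetreK_lebesgue_le hκ f hu
    _ ≤ (2 : ℝ≥0) * (C * leftNorm (-θ) r b q a fun u => ENNReal.ofReal u * rearr f (u ^ κ)) := by
        gcongr
        exact leftNorm_le_mul_of_normOn_le fun t => hC _ (rearr_antitone f) t

theorem LKL_one (p r : ℝ≥0∞) (b : ℝ → ℝ) (q : ℝ≥0∞) :
    LKL μ 𝕜 p r b q (fun _ => 1) = SmallLK μ 𝕜 p q r b := by
  simp only [LKL, SmallLK, leftNorm, mul_one]

end spaces

end LorentzKaramata

open LorentzKaramata in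
theorem theorem5p2_general {Ω : Type*} [MeasurableSpace Ω] (μ : Measure Ω) (𝕜 : Type*) [RCLike 𝕜]
    {ε θ κ : ℝ} (hεθ : ε < θ) (hθ : θ ≤ 1) (hκ : 0 < κ) {q r : ℝ≥0∞} (hq : 0 < q) (hr : 0 < r)
    {a b : ℝ → ℝ} (ha : UpperType ε a) (hb : ∀ t ∈ Ioi (0 : ℝ), 0 < b t) :
    (interpL (Lebesgue μ 𝕜 (ENNReal.ofReal κ)) (Lebesgue μ 𝕜 ∞) θ r b q a).Same
        (interpL (WeakLebesgue μ 𝕜 (ENNReal.ofReal κ)) (Lebesgue μ 𝕜 ∞) θ r b q a) ∧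
      (interpL (WeakLebesgue μ 𝕜 (ENNReal.ofReal κ)) (Lebesgue μ 𝕜 ∞) θ r b q a).Same
        (LKL μ 𝕜 (ENNReal.ofReal κ / ENNReal.ofReal (1 - θ)) r (fun t => b (t ^ (1 / κ))) q
          fun t => a (t ^ (1 / κ))) :=
  have hLW := interpL_lebesgue_embeds_interpL_weakLebesgue μ 𝕜 (θ := θ) hκ hq hr ha.pos hb
  have hWR := interpL_weakLebesgue_embeds_LKL μ 𝕜 hθ hκ hq hr ha.pos hb
  have hRL := LKL_embeds_interpL_lebesgue μ 𝕜 hεθ hθ hκ hq hr ha hb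
  ⟨⟨hLW, hWR.trans hRL⟩, hWR, hRL.trans hLW⟩

theorem theorem5p2 {Ω : Type*} [MeasurableSpace Ω] (μ : Measure Ω) [SigmaFinite μ]
    (hμ : LorentzKaramata.NonAtomic μ) (𝕜 : Type*) [RCLike 𝕜]
    (θ κ : ℝ) (hθ₀ : 0 < θ) (hθ₁ : θ ≤ 1) (hκ : 0 < κ)
    (p : ℝ≥0∞) (hp : p = ENNReal.ofReal κ / ENNReal.ofReal (1 - θ))
    (q r : ℝ≥0∞) (hq : 0 < q) (hr : 0 < r) (a b : ℝ → ℝ)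
    (ha : LorentzKaramata.SlowlyVarying a) (hb : LorentzKaramata.SlowlyVarying b) :
    let Lκ := LorentzKaramata.Lebesgue μ 𝕜 (ENNReal.ofReal κ)
    let Lκw := LorentzKaramata.WeakLebesgue μ 𝕜 (ENNReal.ofReal κ)
    let Linf := LorentzKaramata.Lebesgue μ 𝕜 ∞
    let a' : ℝ → ℝ := fun t => a (t ^ (1 / κ))
    let b' : ℝ → ℝ := fun t => b (t ^ (1 / κ))
    let one : ℝ → ℝ := fun _ => 1
    ((LorentzKaramata.interpL Lκ Linf θ r b q a).Same
        (LorentzKaramata.interpL Lκw Linf θ r b q a) ∧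
      (LorentzKaramata.interpL Lκw Linf θ r b q a).Same
        (LorentzKaramata.LKL μ 𝕜 p r b' q a')) ∧
    ((LorentzKaramata.interpL Lκ Linf θ r b q one).Same
        (LorentzKaramata.interpL Lκw Linf θ r b q one) ∧
      (LorentzKaramata.interpL Lκw Linf θ r b q one).Same
        (LorentzKaramata.SmallLK μ 𝕜 p q r b')) := by
  subst hp
  exact ⟨theorem5p2_general μ 𝕜 (half_lt_self hθ₀) hθ₁ hκ hq hr (ha.upperType (half_pos hθ₀))
      hb.pos,
    LorentzKaramata.LKL_one μ 𝕜 .. ▸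
      theorem5p2_general μ 𝕜 hθ₀ hθ₁ hκ hq hr LorentzKaramata.upperType_one hb.pos⟩
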